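/- Let $\mathcal D_2^{\mathrm U}$ be the set of all distributions of sums $X_1+X_2$, where $X_1,X_2$ are random variables on a common probability space, each uniformly distributed on $[0,1]$, with arbitrary dependence. For $x>0$ let $$\lceil x\rfloor=\min\left\{\frac{\lceil x\rceil}{x}-1,\;1-\frac{\lfloor x\rfloor}{x}\right\}.$$ Let $0<b\le a\le 1$ and let $F=(f_1,f_2,f_3)$ be a probability distribution with mean $1$ supported in $\{a-b,a,a+b\}$, with masses $f_1=F(\{a-b\})\ge 0$, $f_2=F(\{a\})\ge 0$, $f_3=F(\{a+b\})\ge 0$, and suppose that $F$ is not the point mass at $a+b$ (that is, $f_3\ne 1$). Then $F\in\mathcal D_2^{\mathrm U}$ if and only if one of the following three cases holds: (i) $a=1$ and $f_2\ge\left\lceil\frac1{2b}\right\rfloor$; (ii) $a<1$ and $\frac1{2b}\in\mathbb N$; (iii) $a<1$, $\frac1{2b}-\frac12\in\mathbb N$ and $f_2\ge a+b-1$. -/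

import Mathlib

open MeasureTheory ProbabilityTheory

/-- The uniform distribution `U[a, b]`: Lebesgue measure conditioned on `[a, b]`. -/
noncomputable def uniformDist (a b : ℝ) : Measure ℝ :=
  ProbabilityTheory.cond volume (Set.Icc a b)

/-- `sumLaws F` is the set `𝒟ₙ(F₁, …, Fₙ)` of all possible distributions of `X₁ + ⋯ + Xₙ`, where
`X₁, …, Xₙ` are random variables on a common probability space with `Xᵢ ∼ Fᵢ` and with arbitrary
dependence. The joint law of `(X₁, …, Xₙ)` lives on `ℝⁿ` and is realised on every atomless
probability space, so letting the space vary gives the same set as fixing an atomless one. -/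
def sumLaws {n : ℕ} (F : Fin n → Measure ℝ) : Set (Measure ℝ) :=
  {G | ∃ (Ω : Type) (_ : MeasurableSpace Ω) (P : Measure Ω) (_ : IsProbabilityMeasure P)
      (X : Fin n → Ω → ℝ),
      (∀ i, HasLaw (X i) (F i) P) ∧ HasLaw (fun ω => ∑ i, X i ω) G P}

/-- `𝒟ₙᵁ`: the possible distributions of the sum of `n` standard uniform random variables. -/
def uniformSumLaws (n : ℕ) : Set (Measure ℝ) :=
  sumLaws (fun _ : Fin n => uniformDist 0 1)

/-- The measure of non-integrity `min {⌈x⌉ / x - 1, 1 - ⌊x⌋ / x}` of a number `x > 0`. -/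
noncomputable def nonIntegrity (x : ℝ) : ℝ :=
  min ((⌈x⌉ : ℝ) / x - 1) (1 - (⌊x⌋ : ℝ) / x)

/-! Replacing `X₂` by `Z = 1 - X₂` turns the question into which couplings of two uniform variables
satisfy `Z = X + c + {b, 0, -b}`, where `c = 1 - a`. Mass, mean and `f₃ ≠ 1` give `0 ≤ c < b`, and
the mean leaves `f₂` as the only free parameter (`eq_of_three_atoms`).

Two test functions give necessity. A character of period `b` satisfies `E e(Z) = e(c) E e(X)`; for
`c ≠ 0` this forces the Fourier coefficient of the uniform law to vanish, so `1 / b` is an integer.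
A square wave `s` with `s(x ± b) = -s(x)` makes `s(Z) + s(X + c)` vanish unless the sum equals `a`,
where it is at most `2`; hence `f₂` is at least the uniform mass of `unmatchedSet b c`
(`integral_squareWave_add`).

For sufficiency, cut `[0, 1)` into cells of length `b`. Swapping paired cells and then rotating each
cell by `c` attains this lower bound; rotating alone gives `f₁ = 0`, which maximises `f₂`. Mixtures
of the two couplings reach every value in between (`mem_uniformSumLaws_of_unmatchedSet_le`). The
three cases come from computing the mass of the unmatched set. -/

/-! ### The uniform law and maps preserving it -/

lemma uniformDist_zero_one : uniformDist 0 1 = volume.restrict (Set.Ico (0 : ℝ) 1) := by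
  rw [uniformDist, ProbabilityTheory.cond, Real.volume_Icc]
  simp [restrict_Ico_eq_restrict_Icc]

instance isProbabilityMeasure_uniformDist_zero_one :
    IsProbabilityMeasure (uniformDist 0 1) := by
  rw [uniformDist_zero_one]
  exact ⟨by simp⟩

lemma ae_uniformDist_mem_Ico : ∀ᵐ x ∂(uniformDist 0 1), x ∈ Set.Ico (0 : ℝ) 1 := by
  rw [uniformDist_zero_one]
  exact ae_restrict_mem measurableSet_Ico

lemma measurePreserving_one_sub_uniformDist :
    MeasurePreserving (fun x : ℝ => 1 - x) (uniformDist 0 1) (uniformDist 0 1) := by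
  have h := (Measure.measurePreserving_sub_left (volume : Measure ℝ) 1).restrict_preimage
    (s := Set.Icc (0 : ℝ) 1) measurableSet_Icc
  have e : (fun x : ℝ => 1 - x) ⁻¹' Set.Icc 0 1 = Set.Icc 0 1 := by
    ext x; simp only [Set.mem_preimage, Set.mem_Icc]; constructor <;> rintro ⟨h1, h2⟩ <;>
      constructor <;> linarith
  rw [e] at h
  rwa [uniformDist_zero_one, restrict_Ico_eq_restrict_Icc]

/-- An injective piecewise translation of `[0, 1)` into itself, with finitely many pieces,
preserves the uniform distribution. -/
lemma measurePreserving_of_piecewise_translation {T : ℝ → ℝ} (hT : Measurable T) (D : Finset ℝ)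
    (hD : ∀ x ∈ Set.Ico (0 : ℝ) 1, T x - x ∈ D)
    (hmaps : Set.MapsTo T (Set.Ico 0 1) (Set.Ico 0 1)) (hinj : Set.InjOn T (Set.Ico 0 1)) :
    MeasurePreserving T (uniformDist 0 1) (uniformDist 0 1) := by
  refine ⟨hT, ?_⟩
  have : IsProbabilityMeasure ((uniformDist 0 1).map T) :=
    Measure.isProbabilityMeasure_map hT.aemeasurable
  -- Domination suffices, as both sides have total mass one.
  refine Measure.eq_of_le_of_isProbabilityMeasure (Measure.le_iff.2 fun A hA => ?_)
  rw [Measure.map_apply hT hA, uniformDist_zero_one, Measure.restrict_apply (hT hA),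
    Measure.restrict_apply hA]
  set B : ℝ → Set ℝ := fun d => (T ⁻¹' A ∩ Set.Ico 0 1) ∩ {x | T x - x = d} with hB
  have hBm : ∀ d, MeasurableSet (B d) := fun d =>
    ((hT hA).inter measurableSet_Ico).inter ((hT.sub measurable_id) (measurableSet_singleton d))
  have hcover : T ⁻¹' A ∩ Set.Ico 0 1 ⊆ ⋃ d ∈ D, B d := by
    intro x hx
    simp only [Set.mem_iUnion]
    exact ⟨T x - x, hD x hx.2, hx, rfl⟩
  have himg : ∀ d, (fun x => d + x) '' B d = T '' B d := fun d =>
    Set.image_congr fun x hx => by have := hx.2; simp only [Set.mem_ofPred_eq] at this; linarith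
  have himgm : ∀ d, MeasurableSet (T '' B d) := fun d => by
    rw [← himg]; exact (measurableEmbedding_addLeft d).measurableSet_image.2 (hBm d)
  calc volume (T ⁻¹' A ∩ Set.Ico 0 1) ≤ volume (⋃ d ∈ D, B d) := measure_mono hcover
    _ ≤ ∑ d ∈ D, volume (B d) := measure_biUnion_finset_le _ _
    _ = ∑ d ∈ D, volume (T '' B d) := by
        refine Finset.sum_congr rfl fun d _ => ?_
        rw [← himg, Set.image_add_left, measure_preimage_add]
    -- Injectivity of `T` makes the translated pieces disjoint.
    _ = volume (⋃ d ∈ D, T '' B d) := by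
        refine (measure_biUnion_finset ?_ fun d _ => himgm d).symm
        intro d _ e _ hde
        refine Set.disjoint_left.2 ?_
        rintro _ ⟨x, hx, rfl⟩ ⟨y, hy, hxy⟩
        have := hinj hy.1.2 hx.1.2 hxy
        subst this
        exact hde (hx.2.symm.trans hy.2)
    _ ≤ volume (A ∩ Set.Ico 0 1) := by
        refine measure_mono (Set.iUnion₂_subset fun d _ => ?_)
        rintro _ ⟨x, hx, rfl⟩
        exact ⟨hx.1.1, hmaps hx.1.2⟩

/-! ### Square wave, cell rotation and cell swap -/

/-- The square wave of period `2 b`, equal to `1` on `[0, b)` and to `-1` on `[b, 2 b)`. -/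
noncomputable def squareWave (b x : ℝ) : ℝ := by
  classical exact if Even ⌊x / b⌋ then 1 else -1

lemma measurableSet_floor_div_mem (b c : ℝ) (p : ℤ → Prop) :
    MeasurableSet {x : ℝ | p ⌊(x + c) / b⌋} :=
  (Int.measurable_floor.comp ((measurable_id.add_const c).div_const b))
    (MeasurableSet.of_discrete (s := {n | p n}))

lemma measurable_squareWave (b : ℝ) : Measurable (squareWave b) := by
  unfold squareWave
  refine Measurable.ite ?_ measurable_const measurable_const
  simpa using measurableSet_floor_div_mem b 0 Even

lemma abs_squareWave (b x : ℝ) : |squareWave b x| = 1 := by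
  unfold squareWave; split_ifs <;> simp

lemma floor_add_div_self {b : ℝ} (hb : 0 < b) (x : ℝ) : ⌊(x + b) / b⌋ = ⌊x / b⌋ + 1 := by
  rw [add_div, div_self hb.ne', Int.floor_add_one]

lemma floor_sub_div_self {b : ℝ} (hb : 0 < b) (x : ℝ) : ⌊(x - b) / b⌋ = ⌊x / b⌋ - 1 := by
  rw [sub_div, div_self hb.ne', Int.floor_sub_one]

lemma squareWave_add {b : ℝ} (hb : 0 < b) (x : ℝ) : squareWave b (x + b) = -squareWave b x := by
  unfold squareWave
  rw [floor_add_div_self hb]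
  by_cases h : Even ⌊x / b⌋ <;> simp [h]

lemma squareWave_sub {b : ℝ} (hb : 0 < b) (x : ℝ) : squareWave b (x - b) = -squareWave b x := by
  have := squareWave_add hb (x - b)
  rw [sub_add_cancel] at this; linarith

lemma floor_div_eq_iff {b : ℝ} (hb : 0 < b) (x : ℝ) (n : ℤ) :
    ⌊x / b⌋ = n ↔ n * b ≤ x ∧ x < (n + 1) * b := by
  rw [Int.floor_eq_iff, le_div_iff₀ hb, div_lt_iff₀ hb]

/-- Rotation by `c` inside each of the cells `[k b, (k + 1) b)`. -/
noncomputable def cellRotation (b c x : ℝ) : ℝ :=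
  if ⌊(x + c) / b⌋ = ⌊x / b⌋ then x + c else x + c - b

open Classical in
/-- The involution of `[0, 1)` exchanging the points of consecutive cells `[k b, (k + 1) b)`,
`k` even, that are not carried to another cell by a translation by `c`. -/
noncomputable def cellSwap (b c x : ℝ) : ℝ :=
  if ⌊(x + c) / b⌋ = ⌊x / b⌋ then
    if Even ⌊x / b⌋ then (if x + b < 1 then x + b else x) else x - b
  else x

lemma measurableSet_same_cell (b c : ℝ) : MeasurableSet {x : ℝ | ⌊(x + c) / b⌋ = ⌊x / b⌋} :=
  measurableSet_eq_fun (Int.measurable_floor.comp ((measurable_id.add_const c).div_const b))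
    (Int.measurable_floor.comp (measurable_id.div_const b))

lemma measurable_cellRotation (b c : ℝ) : Measurable (cellRotation b c) :=
  Measurable.ite (measurableSet_same_cell b c) (by fun_prop) (by fun_prop)

lemma measurable_cellSwap (b c : ℝ) : Measurable (cellSwap b c) := by
  refine Measurable.ite (measurableSet_same_cell b c) (Measurable.ite ?_ (Measurable.ite
    (measurableSet_lt (by fun_prop) (by fun_prop)) (by fun_prop) (by fun_prop)) (by fun_prop))
    (by fun_prop)
  simpa using measurableSet_floor_div_mem b 0 Even

lemma floor_add_div_of_ne {b c : ℝ} (hb : 0 < b) (hc : 0 ≤ c) (hcb : c < b) {x : ℝ}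
    (h : ⌊(x + c) / b⌋ ≠ ⌊x / b⌋) : ⌊(x + c) / b⌋ = ⌊x / b⌋ + 1 := by
  obtain ⟨h1, h2⟩ := (floor_div_eq_iff hb x _).1 rfl
  have h3 : ⌊x / b⌋ ≤ ⌊(x + c) / b⌋ := Int.floor_le_floor (by gcongr; linarith)
  have h4 : ⌊(x + c) / b⌋ ≤ ⌊(x + b) / b⌋ := Int.floor_le_floor (by gcongr)
  rw [floor_add_div_self hb] at h4
  omega

lemma floor_cellRotation_div {b c : ℝ} (hb : 0 < b) (hc : 0 ≤ c) (hcb : c < b) (x : ℝ) :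
    ⌊cellRotation b c x / b⌋ = ⌊x / b⌋ := by
  unfold cellRotation
  split_ifs with h
  · exact h
  · rw [floor_sub_div_self hb, floor_add_div_of_ne hb hc hcb h]; ring

lemma cellRotation_injective {b c : ℝ} (hb : 0 < b) (hc : 0 ≤ c) (hcb : c < b) :
    Function.Injective (cellRotation b c) := by
  intro x y hxy
  have hf : ⌊x / b⌋ = ⌊y / b⌋ := by
    rw [← floor_cellRotation_div hb hc hcb, hxy, floor_cellRotation_div hb hc hcb]
  obtain ⟨h1, h2⟩ := (floor_div_eq_iff hb x _).1 rfl
  obtain ⟨h3, h4⟩ := (floor_div_eq_iff hb y _).1 hf.symm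
  unfold cellRotation at hxy
  split_ifs at hxy <;> linarith

/-- A last cell truncated by `1` could be rotated out of `[0, 1)`; this is excluded when the cells
tile the interval, and is harmless when the rotation is the identity. -/
lemma mapsTo_cellRotation {b c : ℝ} (hb : 0 < b) (hc : 0 ≤ c) (hcb : c < b)
    (h : c = 0 ∨ ∃ N : ℕ, N * b = 1) :
    Set.MapsTo (cellRotation b c) (Set.Ico 0 1) (Set.Ico 0 1) := by
  rintro x ⟨hx0, hx1⟩
  have hr := floor_cellRotation_div hb hc hcb x
  obtain ⟨h1, h2⟩ := (floor_div_eq_iff hb _ _).1 hr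
  have hk : (0 : ℤ) ≤ ⌊x / b⌋ := Int.floor_nonneg.2 (by positivity)
  have hk' : (0 : ℝ) ≤ ⌊x / b⌋ := by exact_mod_cast hk
  refine ⟨le_trans (by positivity) h1, ?_⟩
  rcases h with rfl | ⟨N, hN⟩
  · simpa [cellRotation] using hx1
  · refine h2.trans_le ?_
    have : ⌊x / b⌋ < (N : ℤ) := by
      rw [Int.floor_lt, div_lt_iff₀ hb]; simpa [hN] using hx1
    have : (⌊x / b⌋ : ℝ) + 1 ≤ N := by exact_mod_cast this
    calc _ ≤ (N : ℝ) * b := by gcongr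
      _ = 1 := hN

lemma measurePreserving_cellRotation {b c : ℝ} (hb : 0 < b) (hc : 0 ≤ c) (hcb : c < b)
    (h : c = 0 ∨ ∃ N : ℕ, N * b = 1) :
    MeasurePreserving (cellRotation b c) (uniformDist 0 1) (uniformDist 0 1) := by
  refine measurePreserving_of_piecewise_translation (measurable_cellRotation b c) {c, c - b}
    (fun x _ => ?_) (mapsTo_cellRotation hb hc hcb h) (cellRotation_injective hb hc hcb).injOn
  unfold cellRotation
  split_ifs <;> simp [add_sub_assoc]

lemma same_cell_add {b c : ℝ} (hb : 0 < b) {x : ℝ} :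
    ⌊(x + b + c) / b⌋ = ⌊(x + b) / b⌋ ↔ ⌊(x + c) / b⌋ = ⌊x / b⌋ := by
  rw [show x + b + c = x + c + b by ring, floor_add_div_self hb, floor_add_div_self hb]
  omega

lemma same_cell_sub {b c : ℝ} (hb : 0 < b) {x : ℝ} :
    ⌊(x - b + c) / b⌋ = ⌊(x - b) / b⌋ ↔ ⌊(x + c) / b⌋ = ⌊x / b⌋ := by
  rw [show x - b + c = x + c - b by ring, floor_sub_div_self hb, floor_sub_div_self hb]
  omega

lemma cellSwap_cellSwap {b c : ℝ} (hb : 0 < b) {x : ℝ} (hx : x ∈ Set.Ico (0 : ℝ) 1) :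
    cellSwap b c (cellSwap b c x) = x := by
  by_cases h : ⌊(x + c) / b⌋ = ⌊x / b⌋
  · by_cases he : Even ⌊x / b⌋
    · by_cases hl : x + b < 1
      · have : cellSwap b c x = x + b := by simp [cellSwap, h, he, hl]
        rw [this, cellSwap, if_pos ((same_cell_add hb).2 h), if_neg]
        · ring
        · simp [floor_add_div_self hb, he]
      · have : cellSwap b c x = x := by simp [cellSwap, h, he, hl]
        rw [this, this]
    · have : cellSwap b c x = x - b := by simp [cellSwap, h, he]
      rw [this, cellSwap, if_pos ((same_cell_sub hb).2 h), if_pos, if_pos]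
      · ring
      · linarith [hx.2]
      · rw [floor_sub_div_self hb, Int.even_sub_one]; exact he
  · have : cellSwap b c x = x := by simp [cellSwap, h]
    rw [this, this]

lemma mapsTo_cellSwap {b c : ℝ} (hb : 0 < b) :
    Set.MapsTo (cellSwap b c) (Set.Ico 0 1) (Set.Ico 0 1) := by
  rintro x ⟨hx0, hx1⟩
  unfold cellSwap
  split_ifs with h he hl
  · exact ⟨by linarith, hl⟩
  · exact ⟨hx0, hx1⟩
  · refine ⟨?_, by linarith⟩
    have hk : (0 : ℤ) ≤ ⌊x / b⌋ := Int.floor_nonneg.2 (by positivity)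
    have hk1 : (1 : ℤ) ≤ ⌊x / b⌋ := by
      rcases hk.eq_or_lt with h0 | h0
      · exact absurd (h0 ▸ Even.zero) he
      · exact h0
    have h2 : ((1 : ℤ) : ℝ) ≤ x / b := Int.le_floor.1 hk1
    rw [le_div_iff₀ hb] at h2
    push_cast at h2; linarith
  · exact ⟨hx0, hx1⟩

lemma measurePreserving_cellSwap {b : ℝ} (hb : 0 < b) (c : ℝ) :
    MeasurePreserving (cellSwap b c) (uniformDist 0 1) (uniformDist 0 1) := by
  refine measurePreserving_of_piecewise_translation (measurable_cellSwap b c) {b, 0, -b}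
    (fun x _ => ?_) (mapsTo_cellSwap hb) ?_
  · unfold cellSwap
    split_ifs <;> simp [sub_eq_add_neg]
  · intro x hx y hy hxy
    rw [← cellSwap_cellSwap (c := c) hb hx, hxy, cellSwap_cellSwap hb hy]

/-- The points moved neither by `cellSwap b c` nor out of their cell by a translation by `c`. -/
def unmatchedSet (b c : ℝ) : Set ℝ :=
  {x | ⌊(x + c) / b⌋ = ⌊x / b⌋ ∧ Even ⌊x / b⌋ ∧ 1 ≤ x + b}

lemma measurableSet_unmatchedSet (b c : ℝ) : MeasurableSet (unmatchedSet b c) := by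
  refine (measurableSet_same_cell b c).inter (MeasurableSet.inter ?_
    (measurableSet_le measurable_const (measurable_id.add_const b)))
  have := measurableSet_floor_div_mem b 0 Even
  simp only [add_zero] at this
  exact this

lemma integrable_of_abs_le_one {Ω : Type*} [MeasurableSpace Ω] {P : Measure Ω}
    [IsProbabilityMeasure P] {f : Ω → ℝ} (hf : AEMeasurable f P) (h : ∀ x, |f x| ≤ 1) :
    Integrable f P :=
  Integrable.of_bound hf.aestronglyMeasurable 1 (ae_of_all _ h)

/-- If translation by `c` changes the cell, the two wave values at `x` cancel. Otherwise they agree,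
and the partner in the adjacent cell carries the opposite sign. A point without partner lies in an
even cell and is its own image, so it counts `2 + 2`. -/
lemma squareWave_add_cellSwap {b c : ℝ} (hb : 0 < b) (hc : 0 ≤ c) (hcb : c < b) (x : ℝ) :
    squareWave b x + squareWave b (x + c) +
      (squareWave b (cellSwap b c x) + squareWave b (cellSwap b c x + c)) =
      (unmatchedSet b c).indicator (fun _ => 4) x := by
  by_cases h : ⌊(x + c) / b⌋ = ⌊x / b⌋
  · by_cases he : Even ⌊x / b⌋
    · by_cases hl : x + b < 1
      · have : cellSwap b c x = x + b := by simp [cellSwap, h, he, hl]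
        rw [this, Set.indicator_of_notMem (fun hx => by linarith [hx.2.2]), squareWave_add hb,
          add_right_comm x b c, squareWave_add hb]
        ring
      · have : cellSwap b c x = x := by simp [cellSwap, h, he, hl]
        have hmem : x ∈ unmatchedSet b c := ⟨h, he, not_lt.1 hl⟩
        rw [this, Set.indicator_of_mem hmem]
        simp only [squareWave, h, he, if_true]
        norm_num
    · have : cellSwap b c x = x - b := by simp [cellSwap, h, he]
      rw [this, Set.indicator_of_notMem (fun hx => he hx.2.1), squareWave_sub hb,
        show x - b + c = x + c - b by ring, squareWave_sub hb]
      ring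
  · have : cellSwap b c x = x := by simp [cellSwap, h]
    rw [this, Set.indicator_of_notMem (fun hx => h hx.1)]
    have : squareWave b (x + c) = - squareWave b x := by
      unfold squareWave
      rw [floor_add_div_of_ne hb hc hcb h]
      by_cases h : Even ⌊x / b⌋ <;> simp [h]
    rw [this]; ring

/-- Since `cellSwap` preserves the measure, integrating the pointwise identity doubles the left side
and yields `4` times the unmatched mass. -/
lemma integral_squareWave_add {b c : ℝ} (hb : 0 < b) (hc : 0 ≤ c) (hcb : c < b) :
    (∫ x, squareWave b x ∂(uniformDist 0 1)) + ∫ x, squareWave b (x + c) ∂(uniformDist 0 1) =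
      2 * (uniformDist 0 1).real (unmatchedSet b c) := by
  have hm := measurable_squareWave b
  have i1 : Integrable (squareWave b) (uniformDist 0 1) :=
    integrable_of_abs_le_one hm.aemeasurable fun x => (abs_squareWave b x).le
  have i2 : Integrable (fun x => squareWave b (x + c)) (uniformDist 0 1) :=
    integrable_of_abs_le_one (hm.comp (by fun_prop)).aemeasurable fun x => (abs_squareWave b _).le
  have hS := measurePreserving_cellSwap hb c
  have i3 := hS.integrable_comp_of_integrable (i1.add i2)
  have e1 : ∫ x, (squareWave b + fun x => squareWave b (x + c)) (cellSwap b c x)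
      ∂(uniformDist 0 1) =
      ∫ x, (squareWave b + fun x => squareWave b (x + c)) x ∂(uniformDist 0 1) := by
    rw [← integral_map hS.measurable.aemeasurable, hS.map_eq]
    rw [hS.map_eq]; exact (i1.add i2).aestronglyMeasurable
  have e2 : ∫ x, (squareWave b + fun x => squareWave b (x + c)) x ∂(uniformDist 0 1) =
      (∫ x, squareWave b x ∂(uniformDist 0 1)) + ∫ x, squareWave b (x + c) ∂(uniformDist 0 1) :=
    integral_add i1 i2
  have e3 := integral_congr_ae (μ := uniformDist 0 1)
    (ae_of_all _ (squareWave_add_cellSwap hb hc hcb))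
  rw [integral_indicator_const _ (measurableSet_unmatchedSet b c)] at e3
  have e4 := integral_add (i1.add i2) i3
  simp only [Function.comp_apply, Pi.add_apply, smul_eq_mul] at *
  linarith

lemma integrable_id_uniformDist : Integrable (fun x : ℝ => x) (uniformDist 0 1) := by
  refine Integrable.of_bound measurable_id.aestronglyMeasurable 1 ?_
  filter_upwards [ae_uniformDist_mem_Ico] with x hx
  rw [Real.norm_eq_abs, abs_le]; constructor <;> linarith [hx.1, hx.2]

/-! ### Laws with three atoms -/

/-- Integration against a measure carried by a finite set. -/
lemma integral_of_finite_support {F : Measure ℝ} [IsFiniteMeasure F] (S : Finset ℝ)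
    (hS : F (S : Set ℝ)ᶜ = 0) (f : ℝ → ℝ) : ∫ x, f x ∂F = ∑ x ∈ S, F.real {x} * f x := by
  have h : F.restrict (S : Set ℝ) = F := Measure.restrict_eq_self_of_ae_mem (mem_ae_iff.2 hS)
  have hi : IntegrableOn f (S : Set ℝ) F := IntegrableOn.finset
  have := setIntegral_finset S hi
  rw [h] at this
  simpa using this

section ThreeAtoms

variable {a b : ℝ} {F : Measure ℝ} [IsProbabilityMeasure F]

lemma integral_of_three_atoms (hb : 0 < b) (hF : F ({a - b, a, a + b} : Set ℝ)ᶜ = 0)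
    (f : ℝ → ℝ) : ∫ x, f x ∂F =
      F.real {a - b} * f (a - b) + (F.real {a} * f a + F.real {a + b} * f (a + b)) := by
  have h := integral_of_finite_support {a - b, a, a + b} (by
    simpa only [Finset.coe_insert, Finset.coe_singleton] using hF) f
  rwa [Finset.sum_insert, Finset.sum_insert, Finset.sum_singleton] at h
  · simp [hb.ne']
  · simp only [Finset.mem_insert, Finset.mem_singleton, not_or]
    constructor <;> intro h <;> linarith

lemma sum_three_atoms (hb : 0 < b) (hF : F ({a - b, a, a + b} : Set ℝ)ᶜ = 0) :
    F.real {a - b} + (F.real {a} + F.real {a + b}) = 1 := by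
  have := integral_of_three_atoms hb hF (fun _ => 1)
  simp at this; exact this.symm

lemma mean_three_atoms (hb : 0 < b) (hF : F ({a - b, a, a + b} : Set ℝ)ᶜ = 0)
    (hm : ∫ x, x ∂F = 1) : b * (F.real {a + b} - F.real {a - b}) = 1 - a := by
  have h1 := sum_three_atoms hb hF
  have h2 := integral_of_three_atoms hb hF (fun x => x)
  rw [hm] at h2
  linear_combination -h2 - a * h1

/-- Three-atomic distributions with given atoms and mean are determined by their middle mass. -/
lemma eq_of_three_atoms {G : Measure ℝ} [IsProbabilityMeasure G] (hb : 0 < b)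
    (hF : F ({a - b, a, a + b} : Set ℝ)ᶜ = 0) (hG : G ({a - b, a, a + b} : Set ℝ)ᶜ = 0)
    (hmF : ∫ x, x ∂F = 1) (hmG : ∫ x, x ∂G = 1) (h : F.real {a} = G.real {a}) : F = G := by
  have f1 := sum_three_atoms hb hF
  have g1 := sum_three_atoms hb hG
  have f2 := mean_three_atoms hb hF hmF
  have g2 := mean_three_atoms hb hG hmG
  have f3 : F.real {a + b} - F.real {a - b} = G.real {a + b} - G.real {a - b} :=
    mul_left_cancel₀ hb.ne' (f2.trans g2.symm)
  refine Measure.ext fun A hA => ?_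
  have e1 := integral_of_three_atoms hb hF (A.indicator fun _ => 1)
  have e2 := integral_of_three_atoms hb hG (A.indicator fun _ => 1)
  rw [integral_indicator_const _ hA, smul_eq_mul, mul_one] at e1 e2
  rw [← measureReal_eq_measureReal_iff, e1, e2, h, show F.real {a - b} = G.real {a - b} by linarith,
    show F.real {a + b} = G.real {a + b} by linarith]

end ThreeAtoms

/-! ### Couplings of two uniform variables -/

/-- The laws of sums of two uniform variables are the laws of `1 + X - Z` with `X`, `Z` uniform. -/
lemma exists_of_mem_uniformSumLaws_two {F : Measure ℝ} (h : F ∈ uniformSumLaws 2) :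
    ∃ (Ω : Type) (_ : MeasurableSpace Ω) (P : Measure Ω) (_ : IsProbabilityMeasure P)
      (X Z : Ω → ℝ), HasLaw X (uniformDist 0 1) P ∧ HasLaw Z (uniformDist 0 1) P ∧
        HasLaw (fun ω => 1 + X ω - Z ω) F P := by
  obtain ⟨Ω, _, P, hP, X, hX, hS⟩ := h
  refine ⟨Ω, _, P, hP, X 0, fun ω => 1 - X 1 ω, hX 0,
    measurePreserving_one_sub_uniformDist.fun_comp_hasLaw (hX 1), ?_⟩
  · convert hS using 2 with ω
    rw [Fin.sum_univ_two]; ring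

lemma mem_uniformSumLaws_two {Ω : Type} [MeasurableSpace Ω] {P : Measure Ω}
    [IsProbabilityMeasure P] {X Z : Ω → ℝ} (hX : HasLaw X (uniformDist 0 1) P)
    (hZ : HasLaw Z (uniformDist 0 1) P) : P.map (fun ω => 1 + X ω - Z ω) ∈ uniformSumLaws 2 := by
  refine ⟨Ω, _, P, inferInstance, ![X, fun ω => 1 - Z ω], ?_, ?_, ?_⟩
  · have h1 := measurePreserving_one_sub_uniformDist.fun_comp_hasLaw hZ
    intro i
    fin_cases i
    · exact hX
    · exact h1
  · simp only [Fin.sum_univ_two, Matrix.cons_val_zero, Matrix.cons_val_one]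
    exact hX.aemeasurable.add (hZ.aemeasurable.const_sub 1)
  · congr 1; ext ω
    simp only [Fin.sum_univ_two, Matrix.cons_val_zero, Matrix.cons_val_one]; ring

lemma integral_eq_one_of_mem_uniformSumLaws_two {F : Measure ℝ} (h : F ∈ uniformSumLaws 2) :
    ∫ x, x ∂F = 1 := by
  obtain ⟨Ω, _, P, _, X, Z, hX, hZ, hS⟩ := exists_of_mem_uniformSumLaws_two h
  have int : ∀ {Y : Ω → ℝ}, HasLaw Y (uniformDist 0 1) P → Integrable Y P := fun {Y} hY => by
    have h := integrable_id_uniformDist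
    rw [← hY.map_eq] at h
    exact h.comp_aemeasurable hY.aemeasurable
  have e := hX.integral_eq.trans hZ.integral_eq.symm
  rw [← hS.integral_eq, integral_sub (f := fun ω => 1 + X ω) ((integrable_const 1).add (int hX))
    (int hZ), integral_add (integrable_const 1) (int hX), e]
  simp

lemma isProbabilityMeasure_of_mem_sumLaws {n : ℕ} {H : Fin n → Measure ℝ} {F : Measure ℝ}
    (h : F ∈ sumLaws H) : IsProbabilityMeasure F := by
  obtain ⟨Ω, _, P, _, X, _, hS⟩ := h
  rw [← hS.map_eq]
  exact Measure.isProbabilityMeasure_map hS.aemeasurable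

/-- Mixing two uniform-preserving couplings. -/
lemma mixture_mem_uniformSumLaws_two {T₀ T₁ : ℝ → ℝ}
    (h₀ : MeasurePreserving T₀ (uniformDist 0 1) (uniformDist 0 1))
    (h₁ : MeasurePreserving T₁ (uniformDist 0 1) (uniformDist 0 1))
    {θ : ℝ} (hθ₀ : 0 ≤ θ) (hθ₁ : θ ≤ 1) :
    ENNReal.ofReal (1 - θ) • (uniformDist 0 1).map (fun x => 1 + x - T₀ x) +
      ENNReal.ofReal θ • (uniformDist 0 1).map (fun x => 1 + x - T₁ x) ∈ uniformSumLaws 2 := by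
  have hw : ENNReal.ofReal (1 - θ) + ENNReal.ofReal θ = 1 := by
    rw [← ENNReal.ofReal_add (by linarith) hθ₀]; simp
  have m₀ : Measurable fun x => (x, T₀ x) := measurable_id.prodMk h₀.measurable
  have m₁ : Measurable fun x => (x, T₁ x) := measurable_id.prodMk h₁.measurable
  -- The joint laws are mixed, not the maps, so both marginals remain uniform.
  set P : Measure (ℝ × ℝ) := ENNReal.ofReal (1 - θ) • (uniformDist 0 1).map (fun x => (x, T₀ x)) +
      ENNReal.ofReal θ • (uniformDist 0 1).map (fun x => (x, T₁ x)) with hP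
  have hmap : ∀ {g : ℝ × ℝ → ℝ}, Measurable g → P.map g =
      ENNReal.ofReal (1 - θ) • (uniformDist 0 1).map (fun x => g (x, T₀ x)) +
      ENNReal.ofReal θ • (uniformDist 0 1).map (fun x => g (x, T₁ x)) := fun {g} hg => by
    rw [hP, Measure.map_add _ _ hg, Measure.map_smul, Measure.map_smul, Measure.map_map hg m₀,
      Measure.map_map hg m₁]
    rfl
  have : IsProbabilityMeasure P := by
    have := Measure.isProbabilityMeasure_map (μ := uniformDist 0 1) m₀.aemeasurable
    have := Measure.isProbabilityMeasure_map (μ := uniformDist 0 1) m₁.aemeasurable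
    constructor
    simp [hP, hw]
  have hX : HasLaw Prod.fst (uniformDist 0 1) P := by
    refine ⟨measurable_fst.aemeasurable, ?_⟩
    rw [hmap measurable_fst]
    simp only [Measure.map_id']
    rw [← add_smul, hw, one_smul]
  have hZ : HasLaw Prod.snd (uniformDist 0 1) P := by
    refine ⟨measurable_snd.aemeasurable, ?_⟩
    rw [hmap measurable_snd]
    simp only [h₀.map_eq, h₁.map_eq]
    rw [← add_smul, hw, one_smul]
  have := mem_uniformSumLaws_two hX hZ
  rwa [hmap (by fun_prop)] at this

/-! ### Necessity: square wave and character -/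

section Necessity

variable {a b : ℝ} {F : Measure ℝ}

lemma integral_comp_of_hasLaw {Ω E : Type*} [MeasurableSpace Ω] {P : Measure Ω} {μ : Measure ℝ}
    [NormedAddCommGroup E] [NormedSpace ℝ E] {X : Ω → ℝ} (hX : HasLaw X μ P) {f : ℝ → E}
    (hf : AEStronglyMeasurable f μ) : ∫ ω, f (X ω) ∂P = ∫ x, f x ∂μ := by
  rw [← hX.map_eq] at hf ⊢
  exact (integral_map hX.aemeasurable hf).symm

/-- The steps allowed by a three-atomic law of the sum. -/
lemma ae_step_of_hasLaw {Ω : Type*} [MeasurableSpace Ω] {P : Measure Ω} {X Z : Ω → ℝ}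
    (hF : F ({a - b, a, a + b} : Set ℝ)ᶜ = 0) (hS : HasLaw (fun ω => 1 + X ω - Z ω) F P) :
    ∀ᵐ ω ∂P, Z ω = X ω + (1 - a) + b ∨ 1 + X ω - Z ω = a ∨ Z ω = X ω + (1 - a) - b := by
  have h : ∀ᵐ y ∂F, y ∈ ({a - b, a, a + b} : Set ℝ) := hF
  rw [← hS.map_eq] at h
  filter_upwards [ae_of_ae_map hS.aemeasurable h] with ω hω
  rcases hω with h | h | h
  · left; linarith
  · right; left; exact h
  · right; right; rw [Set.mem_singleton_iff] at h; linarith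

/-- A step of `c ± b` flips the wave relative to `X + c`, so only the event that the sum equals `a`
can contribute to the expectation, by at most `2`. -/
lemma unmatchedSet_le_of_mem_uniformSumLaws (hb : 0 < b) (ha : a ≤ 1) (hab : 1 - a < b)
    (hF : F ({a - b, a, a + b} : Set ℝ)ᶜ = 0) (h : F ∈ uniformSumLaws 2) :
    (uniformDist 0 1).real (unmatchedSet b (1 - a)) ≤ F.real {a} := by
  obtain ⟨Ω, _, P, _, X, Z, hX, hZ, hS⟩ := exists_of_mem_uniformSumLaws_two h
  have hm := measurable_squareWave b
  have hm' : Measurable fun x => squareWave b (x + (1 - a)) := hm.comp (by fun_prop)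
  have key := integral_squareWave_add hb (sub_nonneg.2 ha) hab
  rw [← integral_comp_of_hasLaw hZ hm.aestronglyMeasurable,
    ← integral_comp_of_hasLaw hX hm'.aestronglyMeasurable, ← integral_add] at key
  rotate_left
  · exact integrable_of_abs_le_one (hm.comp_aemeasurable hZ.aemeasurable)
      fun x => (abs_squareWave b _).le
  · exact integrable_of_abs_le_one (hm'.comp_aemeasurable hX.aemeasurable)
      fun x => (abs_squareWave b _).le
  have hfin : ∫ y, ({a} : Set ℝ).indicator (fun _ => (2 : ℝ)) y ∂F = 2 * F.real {a} := by
    rw [integral_indicator_const _ (measurableSet_singleton a), smul_eq_mul, mul_comm]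
  have hmi : Measurable (({a} : Set ℝ).indicator (fun _ => (2 : ℝ))) :=
    measurable_const.indicator (measurableSet_singleton a)
  rw [← integral_comp_of_hasLaw hS hmi.aestronglyMeasurable] at hfin
  have hle : ∫ ω, squareWave b (Z ω) + squareWave b (X ω + (1 - a)) ∂P ≤ 2 * F.real {a} := by
    rw [← hfin]
    refine integral_mono_ae ?_ ?_ ?_
    · exact (integrable_of_abs_le_one (hm.comp_aemeasurable hZ.aemeasurable)
        fun x => (abs_squareWave b _).le).add
        (integrable_of_abs_le_one (hm'.comp_aemeasurable hX.aemeasurable)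
          fun x => (abs_squareWave b _).le)
    · refine Integrable.of_bound (hmi.comp_aemeasurable hS.aemeasurable).aestronglyMeasurable 2
        (ae_of_all _ fun ω => ?_)
      simp only [Set.indicator]
      split_ifs <;> simp
    · filter_upwards [ae_step_of_hasLaw hF hS] with ω hω
      have hnn : 0 ≤ ({a} : Set ℝ).indicator (fun _ => (2 : ℝ)) (1 + X ω - Z ω) :=
        Set.indicator_nonneg (fun _ _ => by norm_num) _
      rcases hω with h | h | h
      · refine le_of_eq_of_le ?_ hnn
        rw [h, squareWave_add hb]; ring
      · rw [h]
        simp only [Set.mem_singleton_iff, Set.indicator_of_mem]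
        linarith [abs_le.1 (abs_squareWave b (Z ω)).le,
          abs_le.1 (abs_squareWave b (X ω + (1 - a))).le]
      · refine le_of_eq_of_le ?_ hnn
        rw [h, squareWave_sub hb]; ring
  linarith

lemma exists_nat_mul_eq_one_of_mem_uniformSumLaws (hb : 0 < b) (ha : a < 1) (hab : 1 - a < b)
    (hF : F ({a - b, a, a + b} : Set ℝ)ᶜ = 0) (h : F ∈ uniformSumLaws 2) :
    ∃ N : ℕ, N * b = 1 := by
  obtain ⟨Ω, _, P, _, X, Z, hX, hZ, hS⟩ := exists_of_mem_uniformSumLaws_two h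
  have hbC : (b : ℂ) ≠ 0 := by exact_mod_cast hb.ne'
  -- The frequency makes `e` exactly `b`-periodic, hence blind to which of the three atoms occurs.
  set w : ℂ := 2 * Real.pi * Complex.I / b with hw
  have hwb : w * b = 2 * Real.pi * Complex.I := div_mul_cancel₀ _ hbC
  have hw0 : w ≠ 0 := div_ne_zero Complex.two_pi_I_ne_zero hbC
  let e : ℝ → ℂ := fun x => Complex.exp (w * x)
  have hec : Continuous e := by fun_prop
  have hadd : ∀ x y : ℝ, e (x + y) = e x * e y := fun x y => by
    simp only [e]; rw [← Complex.exp_add]; push_cast; ring_nf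
  have heb : e b = 1 := by simp only [e]; rw [hwb, Complex.exp_two_pi_mul_I]
  have hsub : ∀ x : ℝ, e (x - b) = e x := fun x => by
    have := hadd (x - b) b
    rw [sub_add_cancel, heb, mul_one] at this; exact this.symm
  have hstep : ∀ᵐ ω ∂P, e (Z ω) = e (X ω) * e (1 - a) := by
    filter_upwards [ae_step_of_hasLaw hF hS] with ω hω
    rcases hω with h | h | h
    · rw [h, hadd, heb, hadd, mul_one]
    · rw [← hadd]; congr 1; linarith
    · rw [h, hsub, hadd]
  have hint := integral_congr_ae hstep
  rw [integral_mul_const, integral_comp_of_hasLaw hZ hec.aestronglyMeasurable,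
    integral_comp_of_hasLaw hX hec.aestronglyMeasurable] at hint
  have hval : ∫ x, e x ∂(uniformDist 0 1) = (Complex.exp w - 1) / w := by
    rw [uniformDist_zero_one, restrict_Ico_eq_restrict_Ioc,
      ← intervalIntegral.integral_of_le zero_le_one]
    simp only [e]
    rw [integral_exp_mul_complex hw0]
    simp
  -- Equality would make `1 - a` an integer multiple of `b`, against `0 < 1 - a < b`.
  have hne : e (1 - a) ≠ 1 := by
    intro h1
    obtain ⟨n, hn⟩ := Complex.exp_eq_one_iff.1 h1
    have h2 : ((1 - a : ℝ) : ℂ) = n * b := by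
      apply mul_left_cancel₀ hw0
      rw [hn]; linear_combination (-n : ℂ) * hwb
    have h3 : 1 - a = n * b := by exact_mod_cast h2
    have h4 : (0 : ℝ) < n := by by_contra! hcon; nlinarith
    have h5 : (n : ℝ) < 1 := by by_contra! hcon; nlinarith
    have h6 : 0 < n := by exact_mod_cast h4
    have h7 : n < 1 := by exact_mod_cast h5
    omega
  have hzero : ∫ x, e x ∂(uniformDist 0 1) = 0 := by
    have : (∫ x, e x ∂(uniformDist 0 1)) * (e (1 - a) - 1) = 0 := by linear_combination -hint
    exact (mul_eq_zero.1 this).resolve_right (sub_ne_zero.2 hne)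
  rw [hval, div_eq_zero_iff, or_iff_left hw0, sub_eq_zero] at hzero
  obtain ⟨n, hn⟩ := Complex.exp_eq_one_iff.1 hzero
  have h2 : (1 : ℂ) = n * b := by
    apply mul_left_cancel₀ hw0
    rw [mul_one]; nth_rewrite 1 [hn]; linear_combination (-n : ℂ) * hwb
  have h3 : (1 : ℝ) = n * b := by exact_mod_cast h2
  have h4 : (0 : ℝ) < n := by by_contra! hcon; nlinarith
  have h5 : 0 ≤ n := by exact_mod_cast h4.le
  lift n to ℕ using h5
  exact ⟨n, by exact_mod_cast h3.symm⟩

end Necessity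

/-! ### Sufficiency: extremal couplings and their mixtures -/

lemma cellRotation_cellSwap_of_same_cell {b c x : ℝ} (hb : 0 < b)
    (h : ⌊(x + c) / b⌋ = ⌊x / b⌋) : cellRotation b c (cellSwap b c x) = cellSwap b c x + c := by
  have : ⌊(cellSwap b c x + c) / b⌋ = ⌊cellSwap b c x / b⌋ := by
    rw [cellSwap, if_pos h]
    split_ifs
    · exact (same_cell_add hb).2 h
    · exact h
    · exact (same_cell_sub hb).2 h
  rw [cellRotation, if_pos this]

lemma cellRotation_cellSwap_of_not_same_cell {b c x : ℝ}
    (h : ⌊(x + c) / b⌋ ≠ ⌊x / b⌋) : cellRotation b c (cellSwap b c x) = x + c - b := by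
  simp [cellRotation, cellSwap, h]

/-- This identifies the event that the sum equals `1 - c = a` under the swap coupling, so its middle
mass is exactly the lower bound. -/
lemma cellRotation_cellSwap_eq_iff {b c x : ℝ} (hb : 0 < b) :
    cellRotation b c (cellSwap b c x) = x + c ↔ x ∈ unmatchedSet b c := by
  by_cases h : ⌊(x + c) / b⌋ = ⌊x / b⌋
  · rw [cellRotation_cellSwap_of_same_cell hb h]
    by_cases he : Even ⌊x / b⌋
    · by_cases hl : x + b < 1
      · simp [cellSwap, unmatchedSet, h, he, hl, hb.ne']
      · simp [cellSwap, unmatchedSet, h, he, hl, not_lt.1 hl]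
    · simp [cellSwap, unmatchedSet, h, he, hb.ne']
  · rw [cellRotation_cellSwap_of_not_same_cell h]
    simp [unmatchedSet, h, hb.ne']

lemma cellRotation_cellSwap_mem {b c : ℝ} (hb : 0 < b) (x : ℝ) :
    1 + x - cellRotation b c (cellSwap b c x) ∈ ({1 - c - b, 1 - c, 1 - c + b} : Set ℝ) := by
  simp only [Set.mem_insert_iff, Set.mem_singleton_iff]
  by_cases h : ⌊(x + c) / b⌋ = ⌊x / b⌋
  · rw [cellRotation_cellSwap_of_same_cell hb h, cellSwap, if_pos h]
    split_ifs
    · left; ring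
    · right; left; ring
    · right; right; ring
  · rw [cellRotation_cellSwap_of_not_same_cell h]
    right; right; ring

lemma cellRotation_mem (b c x : ℝ) :
    1 + x - cellRotation b c x ∈ ({1 - c, 1 - c + b} : Set ℝ) := by
  simp only [Set.mem_insert_iff, Set.mem_singleton_iff, cellRotation]
  split_ifs
  · left; ring
  · right; ring

/-- Every admissible middle mass is attained. -/
lemma mem_uniformSumLaws_of_unmatchedSet_le {a b : ℝ} {F : Measure ℝ} [IsProbabilityMeasure F]
    (hb : 0 < b) (ha : a ≤ 1) (hab : 1 - a < b) (hF : F ({a - b, a, a + b} : Set ℝ)ᶜ = 0)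
    (hm : ∫ x, x ∂F = 1) (h : a = 1 ∨ ∃ N : ℕ, N * b = 1)
    (hle : (uniformDist 0 1).real (unmatchedSet b (1 - a)) ≤ F.real {a}) :
    F ∈ uniformSumLaws 2 := by
  set c := 1 - a with hc
  have hac : a = 1 - c := by rw [hc]; ring
  have hc0 : 0 ≤ c := sub_nonneg.2 ha
  have h' : c = 0 ∨ ∃ N : ℕ, N * b = 1 := h.imp_left fun h => by rw [hc, h, sub_self]
  have p₁ := measurePreserving_cellRotation hb hc0 hab h'
  have p₀ := p₁.comp (measurePreserving_cellSwap hb c)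
  set S₀ : ℝ → ℝ := fun x => 1 + x - cellRotation b c (cellSwap b c x) with hS₀
  set S₁ : ℝ → ℝ := fun x => 1 + x - cellRotation b c x with hS₁
  have m₀ : Measurable S₀ := by
    have := p₀.measurable; exact (measurable_id.const_add 1).sub this
  have m₁ : Measurable S₁ := by
    have := p₁.measurable; exact (measurable_id.const_add 1).sub this
  set G₀ := (uniformDist 0 1).map S₀ with hG₀
  set G₁ := (uniformDist 0 1).map S₁ with hG₁
  have : IsProbabilityMeasure G₀ := Measure.isProbabilityMeasure_map m₀.aemeasurable
  have : IsProbabilityMeasure G₁ := Measure.isProbabilityMeasure_map m₁.aemeasurable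
  have hmeas : MeasurableSet ({a - b, a, a + b} : Set ℝ) := (Set.toFinite _).measurableSet
  have s₀ : G₀ ({a - b, a, a + b} : Set ℝ)ᶜ = 0 := by
    rw [hG₀, Measure.map_apply m₀ hmeas.compl, Set.preimage_compl, hac]
    rw [Set.preimage_eq_univ_iff.2, Set.compl_univ, measure_empty]
    rintro _ ⟨x, rfl⟩
    exact cellRotation_cellSwap_mem hb x
  have t₁ : G₁ ({a, a + b} : Set ℝ)ᶜ = 0 := by
    rw [hG₁, Measure.map_apply m₁ (Set.toFinite _).measurableSet.compl, Set.preimage_compl, hac]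
    rw [Set.preimage_eq_univ_iff.2, Set.compl_univ, measure_empty]
    rintro _ ⟨x, rfl⟩
    exact cellRotation_mem b c x
  have s₁ : G₁ ({a - b, a, a + b} : Set ℝ)ᶜ = 0 :=
    measure_mono_null (Set.compl_subset_compl.2 (Set.subset_insert _ _)) t₁
  have v₀ : G₀.real {a} = (uniformDist 0 1).real (unmatchedSet b c) := by
    rw [hG₀, map_measureReal_apply m₀ (measurableSet_singleton a)]
    congr 1
    ext x
    rw [← cellRotation_cellSwap_eq_iff hb, Set.mem_preimage, Set.mem_singleton_iff, hS₀, hac]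
    constructor <;> intro h <;> linarith
  have e₁ : G₁.real {a - b} = 0 := by
    rw [measureReal_eq_zero_iff]
    refine measure_mono_null ?_ t₁
    simp [hb.ne']
    linarith
  have hG₁m : ∫ x, x ∂G₁ = 1 :=
    integral_eq_one_of_mem_uniformSumLaws_two (mem_uniformSumLaws_two .id p₁.hasLaw)
  -- The mean fixes `f₃ - f₁ = d`, so `f₂ = 1 - d - 2 f₁` is largest when `f₁ = 0`, as for `G₁`.
  have hupper : F.real {a} ≤ G₁.real {a} := by
    have q1 := sum_three_atoms hb hF
    have q2 := mean_three_atoms hb hF hm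
    have q3 := sum_three_atoms hb s₁
    have q4 := mean_three_atoms hb s₁ hG₁m
    have q5 := mul_left_cancel₀ hb.ne' (q2.trans q4.symm)
    have q6 : 0 ≤ F.real {a - b} := measureReal_nonneg
    linarith
  rw [← v₀] at hle
  obtain ⟨s, t, hs, ht, hst, hθ⟩ : F.real {a} ∈ segment ℝ (G₀.real {a}) (G₁.real {a}) := by
    rw [segment_eq_Icc (hle.trans hupper)]; exact ⟨hle, hupper⟩
  have hs' : s = 1 - t := by linarith
  subst hs'
  have hmix := mixture_mem_uniformSumLaws_two p₀ p₁ ht (by linarith)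
  have : IsProbabilityMeasure (ENNReal.ofReal (1 - t) • G₀ + ENNReal.ofReal t • G₁) :=
    isProbabilityMeasure_of_mem_sumLaws hmix
  have hFG : F = ENNReal.ofReal (1 - t) • G₀ + ENNReal.ofReal t • G₁ := by
    refine eq_of_three_atoms hb hF ?_ hm (integral_eq_one_of_mem_uniformSumLaws_two hmix) ?_
    · rw [Measure.add_apply, Measure.smul_apply, Measure.smul_apply, s₀, s₁, smul_zero, smul_zero,
        add_zero]
    · rw [← hθ, measureReal_add_apply
          (h₁ := ENNReal.mul_ne_top ENNReal.ofReal_ne_top (measure_ne_top _ _))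
          (h₂ := ENNReal.mul_ne_top ENNReal.ofReal_ne_top (measure_ne_top _ _)),
        measureReal_ennreal_smul_apply, measureReal_ennreal_smul_apply, ENNReal.toReal_ofReal hs,
        ENNReal.toReal_ofReal ht, smul_eq_mul, smul_eq_mul]
  rw [hFG]
  exact hmix

/-! ### Mass of the unmatched set -/

lemma uniformDist_real_of_inter_eq {A : Set ℝ} {u v : ℝ} (h : A ∩ Set.Ico 0 1 = Set.Ico u v)
    (huv : u ≤ v) : (uniformDist 0 1).real A = v - u := by
  rw [uniformDist_zero_one, measureReal_restrict_apply' measurableSet_Ico, h,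
    Real.volume_real_Ico_of_le huv]

/-- Writing `⌊x⌋ + 1` for `⌈x⌉` is harmless at integers: the other term is `0` there and still gives
the minimum. -/
lemma nonIntegrity_eq {b : ℝ} (hb : 0 < b) :
    nonIntegrity (1 / (2 * b)) =
      min (1 - 2 * b * ⌊1 / (2 * b)⌋) (2 * b * (⌊1 / (2 * b)⌋ + 1) - 1) := by
  have e : ∀ y : ℝ, y / (1 / (2 * b)) = 2 * b * y := fun y => by field_simp
  rw [nonIntegrity, e, e, min_comm]
  set x := 1 / (2 * b) with hx
  have hbx : 2 * b * x = 1 := by rw [hx]; field_simp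
  by_cases h : x = ⌊x⌋
  · have h1 : (⌈x⌉ : ℝ) = ⌊x⌋ := by rw [h]; simp
    rw [h1, ← h, hbx, mul_add, hbx]
    rw [min_eq_left (by linarith), min_eq_left (by linarith)]
  · have : ⌈x⌉ = ⌊x⌋ + 1 := by
      apply Int.ceil_eq_iff.2
      push_cast
      exact ⟨by rw [add_sub_cancel_right]; exact (Int.floor_le x).lt_of_ne (Ne.symm h),
        (Int.lt_floor_add_one x).le⟩
    rw [this]; push_cast; rfl

/-- Only the last even cell, starting at `2 b k`, can contain unmatched points. If its odd partner
does not start before `1`, all of it inside `[0, 1)` is unmatched; otherwise only the part whose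
partner would lie beyond `1`. -/
lemma uniformDist_unmatchedSet_zero {b : ℝ} (hb : 0 < b) (hb1 : b ≤ 1) :
    (uniformDist 0 1).real (unmatchedSet b 0) = nonIntegrity (1 / (2 * b)) := by
  rw [nonIntegrity_eq hb]
  set k := ⌊1 / (2 * b)⌋ with hk
  obtain ⟨h1, h2⟩ := (floor_div_eq_iff (by positivity : 0 < 2 * b) 1 k).1 rfl
  have hk0 : 0 ≤ k := Int.floor_nonneg.2 (by positivity)
  have hk0' : (0 : ℝ) ≤ k := by exact_mod_cast hk0
  have hset : unmatchedSet b 0 ∩ Set.Ico 0 1 =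
      Set.Ico (max (2 * b * k) (1 - b)) (min 1 (2 * b * k + b)) := by
    ext x
    simp only [unmatchedSet, add_zero, true_and, Set.mem_inter_iff, Set.mem_ofPred_eq, Set.mem_Ico,
      max_le_iff, lt_min_iff]
    constructor
    · rintro ⟨⟨⟨m, hm⟩, hx⟩, hx0, hx1⟩
      obtain ⟨h3, h4⟩ := (floor_div_eq_iff hb x _).1 hm
      push_cast at h3 h4
      have hmk : m = k := by
        have u1 : (m : ℝ) < k + 1 := by by_contra! hcon; nlinarith
        have u2 : (k : ℝ) < m + 1 := by by_contra! hcon; nlinarith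
        have u3 : m < k + 1 := by exact_mod_cast u1
        have u4 : k < m + 1 := by exact_mod_cast u2
        omega
      subst hmk
      refine ⟨⟨by linarith, by linarith⟩, hx1, by linarith⟩
    · rintro ⟨⟨h3, h4⟩, h5, h6⟩
      refine ⟨⟨⟨k, (floor_div_eq_iff hb x _).2 ?_⟩, by linarith⟩, by nlinarith, h5⟩
      push_cast
      constructor <;> linarith
  rw [uniformDist_real_of_inter_eq hset]
  · rcases le_total (2 * b * k) (1 - b) with h | h
    · rw [max_eq_right h, min_eq_right (by linarith), min_eq_right (by linarith)]; ring
    · rw [max_eq_left h, min_eq_left (by linarith), min_eq_left (by linarith)]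
  · refine max_le (le_min (by linarith) (by linarith)) (le_min (by linarith) (by linarith))

/-- With an even number of full cells the last one has odd index, so every even cell has a full
partner. -/
lemma uniformDist_unmatchedSet_of_even {b c : ℝ} (hb : 0 < b) {k : ℕ} (hk : (2 * k : ℝ) * b = 1) :
    (uniformDist 0 1).real (unmatchedSet b c) = 0 := by
  have hset : unmatchedSet b c ∩ Set.Ico 0 1 = Set.Ico 0 0 := by
    rw [Set.Ico_self, Set.eq_empty_iff_forall_notMem]
    rintro x ⟨⟨-, ⟨m, hm⟩, hx⟩, -, hx1⟩
    have : ⌊x / b⌋ = 2 * k - 1 := by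
      rw [floor_div_eq_iff hb]
      push_cast
      constructor <;> linarith
    omega
  rw [uniformDist_real_of_inter_eq hset le_rfl, sub_self]

/-- With an odd number of full cells the last one, `[1 - b, 1)`, has no partner; its points staying
in the cell after translation by `c` form `[1 - b, 1 - c)`. -/
lemma uniformDist_unmatchedSet_of_odd {b c : ℝ} (hb : 0 < b) (hc : 0 ≤ c) (hcb : c < b) {k : ℕ}
    (hk : (2 * k + 1 : ℝ) * b = 1) : (uniformDist 0 1).real (unmatchedSet b c) = b - c := by
  have hset : unmatchedSet b c ∩ Set.Ico 0 1 = Set.Ico (1 - b) (1 - c) := by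
    have key : ∀ x, 1 - b ≤ x → x < 1 → ⌊x / b⌋ = 2 * k := fun x h1 h2 => by
      rw [floor_div_eq_iff hb]
      push_cast
      constructor <;> linarith
    ext x
    constructor
    · rintro ⟨⟨h1, -, hx⟩, -, hx1⟩
      have h2 := key x (by linarith) hx1
      rw [h2, floor_div_eq_iff hb] at h1
      push_cast at h1
      exact ⟨by linarith, by linarith⟩
    · rintro ⟨h1, h2⟩
      have e1 := key x h1 (by linarith)
      have e2 := key (x + c) (by linarith) (by linarith)
      have : 0 ≤ (2 * k : ℝ) * b := by positivity
      exact ⟨⟨e2.trans e1.symm, e1 ▸ even_two_mul _, by linarith⟩, by linarith, by linarith⟩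
  rw [uniformDist_real_of_inter_eq hset (by linarith)]; ring

/-! ### The characterization -/

theorem theorem3 (a b : ℝ) (hb : 0 < b) (hba : b ≤ a) (ha : a ≤ 1)
    (F : Measure ℝ) [IsProbabilityMeasure F]
    (hsupp : F ({a - b, a, a + b} : Set ℝ)ᶜ = 0)
    (hmean : ∫ x, x ∂F = 1)
    (hnd : F.real {a + b} ≠ 1) :
    F ∈ uniformSumLaws 2 ↔
      (a = 1 ∧ nonIntegrity (1 / (2 * b)) ≤ F.real {a}) ∨
      (a < 1 ∧ ∃ k : ℕ, 1 / (2 * b) = (k : ℝ)) ∨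
      (a < 1 ∧ (∃ k : ℕ, 1 / (2 * b) - 1 / 2 = (k : ℝ)) ∧ a + b - 1 ≤ F.real {a}) := by
  -- The mean gives `1 - a = b (f₃ - f₁)`, and `f₃ < 1` makes this strictly less than `b`.
  have hab : 1 - a < b := by
    have h1 := sum_three_atoms hb hsupp
    have h2 := mean_three_atoms hb hsupp hmean
    have n1 : 0 ≤ F.real {a - b} := measureReal_nonneg
    have n2 : 0 ≤ F.real {a} := measureReal_nonneg
    have h3 : F.real {a + b} < 1 := lt_of_le_of_ne measureReal_le_one hnd
    nlinarith
  have hc0 : 0 ≤ 1 - a := sub_nonneg.2 ha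
  have even_iff : ∀ k : ℕ, 1 / (2 * b) = (k : ℝ) ↔ (2 * k : ℝ) * b = 1 := fun k => by
    rw [div_eq_iff (by positivity)]
    constructor <;> intro h <;> linarith
  have odd_iff : ∀ k : ℕ, 1 / (2 * b) - 1 / 2 = (k : ℝ) ↔ (2 * k + 1 : ℝ) * b = 1 := fun k => by
    rw [sub_eq_iff_eq_add, div_eq_iff (by positivity)]
    constructor <;> intro h <;> linarith
  simp only [even_iff, odd_iff]
  constructor
  · intro h
    have hle := unmatchedSet_le_of_mem_uniformSumLaws hb ha hab hsupp h
    rcases ha.eq_or_lt with rfl | ha'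
    · left
      rw [sub_self, uniformDist_unmatchedSet_zero hb hba] at hle
      exact ⟨rfl, hle⟩
    · right
      obtain ⟨N, hN⟩ := exists_nat_mul_eq_one_of_mem_uniformSumLaws hb ha' hab hsupp h
      obtain ⟨k, rfl | rfl⟩ := N.even_or_odd'
      · exact Or.inl ⟨ha', k, by exact_mod_cast hN⟩
      · have hk : (2 * k + 1 : ℝ) * b = 1 := by exact_mod_cast hN
        rw [uniformDist_unmatchedSet_of_odd hb hc0 hab hk] at hle
        exact Or.inr ⟨ha', ⟨k, hk⟩, by linarith⟩
  · rintro (⟨rfl, h⟩ | ⟨-, k, hk⟩ | ⟨-, ⟨k, hk⟩, h⟩)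
    · refine mem_uniformSumLaws_of_unmatchedSet_le hb ha hab hsupp hmean (Or.inl rfl) ?_
      rwa [sub_self, uniformDist_unmatchedSet_zero hb hba]
    · refine mem_uniformSumLaws_of_unmatchedSet_le hb ha hab hsupp hmean
        (Or.inr ⟨2 * k, by exact_mod_cast hk⟩) ?_
      rw [uniformDist_unmatchedSet_of_even hb hk]
      exact measureReal_nonneg
    · refine mem_uniformSumLaws_of_unmatchedSet_le hb ha hab hsupp hmean
        (Or.inr ⟨2 * k + 1, by exact_mod_cast hk⟩) ?_
      rw [uniformDist_unmatchedSet_of_odd hb hc0 hab hk]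
      linarith
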